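/- Let $g\ge 0$ and let $\mathbb{R}\langle x\rangle$ be the algebra of noncommutative polynomials in $x=(x_1,\dots,x_g)$ with real coefficients. The transpose $p\mapsto p^T$ is the linear map reversing every monomial, so $x_i^T=x_i$; $p$ is symmetric if $p^T=p$. A polynomial is homogeneous of degree $m$ if all monomials occurring in it have length $m$ (so $0$ is homogeneous of every degree). Let $h$ be a further noncommuting variable with $h^T=h$, and define $$\mathrm{Lap}[p,h]=\sum_{i=1}^g D_i(D_i p),\qquad D_i q=\frac{d}{dt}\,q(x_1,\dots,x_i+th,\dots,x_g,h)\Big|_{t=0}.$$ The polynomial $p$ is harmonic if $\mathrm{Lap}[p,h]=0$, and subharmonic if $\mathrm{Lap}[p,h]$ is symmetric and takes a positive semidefinite value at all real symmetric $n\times n$ matrices $X_1,\dots,X_g,H$ substituted for $x_1,\dots,x_g,h$, for every $n$. Theorem 1.2. Let $d\ge 0$ be even. Assume that the real vector space of harmonic polynomials homogeneous of degree $d/2$ has a basis $\gamma_1,\dots,\gamma_k$ such that, for each $j$, there is a monomial $w_j$ which occurs in $\gamma_j$ and in no $\gamma_l$ with $l\ne j$. If $p\in\mathbb{R}\langle x\rangle$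 is symmetric, subharmonic and homogeneous of degree $d$, then $$p=\sum_{i=1}^{N} c_i R_i^T R_i$$ for some finite $N$, real numbers $c_1,\dots,c_N$, and harmonic polynomials $R_1,\dots,R_N$ homogeneous of degree $d/2$. -/

import Mathlib

noncomputable section

namespace NCPoly

open Polynomial

/-- Noncommutative polynomials with real coefficients in the free symmetric variables `σ`.
Mathlib's `star` on this algebra is the transpose: it fixes every variable and every real
scalar and reverses products. -/
abbrev Poly (σ : Type) : Type := FreeAlgebra ℝ σ

/-- The coefficient in `p` of the monomial `w`, a word in the variables. -/
def coeff {σ : Type} (p : Poly σ) (w : FreeMonoid σ) : ℝ :=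
  (FreeAlgebra.equivMonoidAlgebraFreeMonoid p : MonoidAlgebra ℝ (FreeMonoid σ)).coeff w

/-- Every monomial occurring in `p` has length `d` (the zero polynomial is allowed). -/
def IsHomogeneous {σ : Type} (p : Poly σ) (d : ℕ) : Prop :=
  ∀ w : FreeMonoid σ, coeff p w ≠ 0 → w.length = d

/-- `p` is symmetric: it equals its transpose. -/
def IsSymmetric {σ : Type} (p : Poly σ) : Prop := star p = p

/-- The value of `p` at a tuple of matrices. -/
def evalMatrix {σ : Type} {n : ℕ} (X : σ → Matrix (Fin n) (Fin n) ℝ) (p : Poly σ) :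
    Matrix (Fin n) (Fin n) ℝ :=
  FreeAlgebra.lift ℝ X p

/-- `p` is symmetric and takes positive semidefinite values at all tuples of real symmetric
matrices of every size. -/
def IsMatrixPositive {σ : Type} (p : Poly σ) : Prop :=
  IsSymmetric p ∧
    ∀ (n : ℕ) (X : σ → Matrix (Fin n) (Fin n) ℝ), (∀ i, (X i).IsSymm) →
      (evalMatrix X p).PosSemidef

/-- The polynomial in a central parameter `t` (written `Polynomial.X`) obtained from `p` by
replacing the variable `i` by `x_i + t h`. -/
def shift {σ : Type} [DecidableEq σ] (i : σ) (h : Poly σ) : Poly σ →ₐ[ℝ] (Poly σ)[X] :=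
  FreeAlgebra.lift ℝ fun j : σ =>
    if j = i then C (FreeAlgebra.ι ℝ j) + X * C h else C (FreeAlgebra.ι ℝ j)

/-- The directional derivative `d/dt p(x_1, …, x_i + t h, …, x_g)` at `t = 0`. -/
def dird {σ : Type} [DecidableEq σ] (p : Poly σ) (i : σ) (h : Poly σ) : Poly σ :=
  (derivative (shift i h p)).eval 0

/-- The Laplacian of a polynomial in `x_1, …, x_g`, a polynomial in these variables
(`some i` for `x_i`) and one further symmetric variable `h` (`none`). -/
def laplacian {g : ℕ} (p : Poly (Fin g)) : Poly (Option (Fin g)) :=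
  ∑ i : Fin g,
    dird
      (dird (FreeAlgebra.lift ℝ (fun j : Fin g => FreeAlgebra.ι ℝ (some j)) p)
        (some i) (FreeAlgebra.ι ℝ none))
      (some i) (FreeAlgebra.ι ℝ none)

/-- `p` is harmonic: its Laplacian is zero. -/
def IsHarmonic {g : ℕ} (p : Poly (Fin g)) : Prop := laplacian p = 0

/-- `p` is subharmonic: its Laplacian is matrix positive. -/
def IsSubharmonic {g : ℕ} (p : Poly (Fin g)) : Prop := IsMatrixPositive (laplacian p)

end NCPoly

end

noncomputable section

namespace NCPoly

open Polynomial

/-! Write d = 2m. Every monomial of Lap[p,h] has length 2m and contains h. If such a monomial s had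
no h among its first m letters, evaluate at the adjacency matrices of a path whose edges spell s. A
closed walk of length 2m from the left end cannot cross an edge labelled h, so the corner diagonal
entry is 0. Positivity kills its whole row, while the entry joining the two ends is the coefficient
of s (`IsMatrixPositive.coeff_eq_zero`).

Stripping an h-free prefix commutes with the Laplacian (`leftQuotient_laplacian`), so the quotients
of p by words of length m are harmonic. Diagonalizing the symmetric matrix of coefficients of p,
indexed by half-words, writes p as a combination of squares of linear combinations of these
quotients (`IsSymmetric.exists_eq_sum_star_mul`). -/

variable {σ : Type}

/-! ### Monomials, coefficients and supports -/

/-- The monomial with underlying word `w`. -/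
def monomial : FreeMonoid σ →* Poly σ := FreeMonoid.lift (FreeAlgebra.ι ℝ)

lemma monomial_of (i : σ) : monomial (FreeMonoid.of i) = FreeAlgebra.ι ℝ i := by
  simp [monomial]

lemma equiv_monomial (w : FreeMonoid σ) :
    FreeAlgebra.equivMonoidAlgebraFreeMonoid (monomial w : Poly σ) =
      MonoidAlgebra.single w (1 : ℝ) := by
  have h : ((FreeAlgebra.equivMonoidAlgebraFreeMonoid :
        Poly σ ≃ₐ[ℝ] MonoidAlgebra ℝ (FreeMonoid σ)) : Poly σ →* _).comp monomial =
      MonoidAlgebra.of ℝ (FreeMonoid σ) := by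
    ext i
    simp [monomial, FreeAlgebra.equivMonoidAlgebraFreeMonoid]
  exact DFunLike.congr_fun h w

/-- Taking all coefficients, as a linear equivalence. -/
def coeffEquiv : Poly σ ≃ₗ[ℝ] (FreeMonoid σ →₀ ℝ) :=
  FreeAlgebra.equivMonoidAlgebraFreeMonoid.toLinearEquiv ≪≫ₗ
    MonoidAlgebra.coeffLinearEquiv ℝ

lemma coeffEquiv_apply (p : Poly σ) (w : FreeMonoid σ) : coeffEquiv p w = coeff p w := rfl

lemma coeffEquiv_monomial (w : FreeMonoid σ) :
    coeffEquiv (monomial w) = Finsupp.single w (1 : ℝ) := by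
  change (FreeAlgebra.equivMonoidAlgebraFreeMonoid (monomial w : Poly σ)).coeff = _
  rw [equiv_monomial]; rfl

lemma coeffEquiv_symm_single (w : FreeMonoid σ) (r : ℝ) :
    coeffEquiv.symm (Finsupp.single w r) = r • monomial w := by
  rw [LinearEquiv.symm_apply_eq, map_smul, coeffEquiv_monomial]; simp

/-- The coefficient at `w` as a linear functional. -/
def coeffLin (w : FreeMonoid σ) : Poly σ →ₗ[ℝ] ℝ :=
  Finsupp.lapply w ∘ₗ coeffEquiv.toLinearMap

lemma coeffLin_apply (w : FreeMonoid σ) (p : Poly σ) : coeffLin w p = coeff p w := rfl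

open Classical in
lemma coeff_monomial (v w : FreeMonoid σ) :
    coeff (monomial v) w = if v = w then 1 else 0 := by
  rw [← coeffEquiv_apply, coeffEquiv_monomial, Finsupp.single_apply]

lemma ext_coeff {p q : Poly σ} (h : ∀ w, coeff p w = coeff q w) : p = q :=
  coeffEquiv.injective (Finsupp.ext h)

lemma eq_sum_monomial (p : Poly σ) :
    p = ∑ w ∈ (coeffEquiv p).support, coeff p w • monomial w := by
  conv_lhs => rw [← coeffEquiv.symm_apply_apply p, ← Finsupp.sum_single (coeffEquiv p)]
  rw [Finsupp.sum, map_sum]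
  exact Finset.sum_congr rfl fun w _ => coeffEquiv_symm_single w _

lemma mem_support {p : Poly σ} {w : FreeMonoid σ} :
    w ∈ (coeffEquiv p).support ↔ coeff p w ≠ 0 := Finsupp.mem_support_iff

/-- The polynomials all of whose monomials satisfy `P`. -/
def supported (P : FreeMonoid σ → Prop) : Submodule ℝ (Poly σ) :=
  Submodule.span ℝ (monomial '' {w | P w})

lemma mem_supported {P : FreeMonoid σ → Prop} {p : Poly σ} :
    p ∈ supported P ↔ ∀ w, coeff p w ≠ 0 → P w := by
  constructor
  · intro hp w hw
    by_contra hP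
    refine hw ?_
    have : supported P ≤ LinearMap.ker (coeffLin w) := by
      refine Submodule.span_le.2 ?_
      rintro _ ⟨v, hv, rfl⟩
      have : v ≠ w := fun h => hP (h ▸ hv)
      simp [coeffLin_apply, coeff_monomial, this]
    exact this hp
  · intro h
    rw [eq_sum_monomial p]
    exact Submodule.sum_mem _ fun w hw => Submodule.smul_mem _ _
      (Submodule.subset_span ⟨w, h w (mem_support.1 hw), rfl⟩)

lemma monomial_mem_supported {P : FreeMonoid σ → Prop} {w : FreeMonoid σ} (h : P w) :
    monomial w ∈ supported P := Submodule.subset_span ⟨w, h, rfl⟩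

lemma isHomogeneous_iff {p : Poly σ} {d : ℕ} :
    IsHomogeneous p d ↔ p ∈ supported (fun w : FreeMonoid σ => w.length = d) :=
  mem_supported.symm

lemma linearMap_ext {M : Type*} [AddCommGroup M] [Module ℝ M] {f f' : Poly σ →ₗ[ℝ] M}
    (h : ∀ w, f (monomial w) = f' (monomial w)) : f = f' := by
  ext p
  rw [eq_sum_monomial p]
  simp [map_sum, h]

lemma ι_mul_mem_supported {P Q : FreeMonoid σ → Prop} (i : σ)
    (h : ∀ w, P w → Q (FreeMonoid.of i * w)) {p : Poly σ} (hp : p ∈ supported P) :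
    FreeAlgebra.ι ℝ i * p ∈ supported Q := by
  have : supported P ≤ (supported Q).comap (LinearMap.mulLeft ℝ (FreeAlgebra.ι ℝ i)) := by
    refine Submodule.span_le.2 ?_
    rintro _ ⟨v, hv, rfl⟩
    change FreeAlgebra.ι ℝ i * monomial v ∈ supported Q
    rw [← monomial_of, ← map_mul]
    exact monomial_mem_supported (h v hv)
  exact this hp

/-! ### Left quotients and the transpose -/

/-- The left quotient of `p` by the word `u`: the coefficient of `w` is that of `u * w` in `p`. -/
def leftQuotient (u : FreeMonoid σ) : Poly σ →ₗ[ℝ] Poly σ :=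
  coeffEquiv.symm.toLinearMap ∘ₗ
    Finsupp.lcomapDomain (u * ·) (mul_right_injective u) ∘ₗ coeffEquiv.toLinearMap

lemma coeff_leftQuotient (u w : FreeMonoid σ) (p : Poly σ) :
    coeff (leftQuotient u p) w = coeff p (u * w) := by
  rw [← coeffEquiv_apply, leftQuotient]
  simp [Finsupp.lcomapDomain, coeffEquiv_apply]

lemma leftQuotient_one (p : Poly σ) : leftQuotient 1 p = p :=
  ext_coeff fun w => by rw [coeff_leftQuotient, one_mul]

lemma leftQuotient_mul (u v : FreeMonoid σ) (p : Poly σ) :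
    leftQuotient (u * v) p = leftQuotient v (leftQuotient u p) :=
  ext_coeff fun w => by simp only [coeff_leftQuotient, mul_assoc]

open Classical in
lemma coeff_ι_mul (i j : σ) (p : Poly σ) (w : FreeMonoid σ) :
    coeff (FreeAlgebra.ι ℝ i * p) (FreeMonoid.of j * w) = if i = j then coeff p w else 0 := by
  have : coeffLin (FreeMonoid.of j * w) ∘ₗ LinearMap.mulLeft ℝ (FreeAlgebra.ι ℝ i) =
      (if i = j then 1 else 0 : ℝ) • coeffLin w := by
    refine linearMap_ext fun v => ?_
    change coeff (FreeAlgebra.ι ℝ i * monomial v) _ = _ * coeff (monomial v) w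
    rw [← monomial_of, ← map_mul, coeff_monomial, coeff_monomial]
    have : FreeMonoid.of i * v = FreeMonoid.of j * w ↔ i = j ∧ v = w :=
      List.cons_eq_cons
    rw [this]
    split_ifs <;> simp_all
  have h := LinearMap.congr_fun this p
  rw [LinearMap.smul_apply, coeffLin_apply] at h
  simpa only [LinearMap.comp_apply, LinearMap.mulLeft_apply, coeffLin_apply,
    smul_eq_mul, ite_mul, one_mul, zero_mul] using h

open Classical in
lemma leftQuotient_of_ι_mul (i j : σ) (p : Poly σ) :
    leftQuotient (FreeMonoid.of j) (FreeAlgebra.ι ℝ i * p) = if i = j then p else 0 :=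
  ext_coeff fun w => by
    rw [coeff_leftQuotient, coeff_ι_mul]
    split_ifs
    · rfl
    · exact (map_zero (coeffLin w)).symm

lemma leftQuotient_of_one (j : σ) : leftQuotient (FreeMonoid.of j) (1 : Poly σ) = 0 :=
  ext_coeff fun w => by
    rw [coeff_leftQuotient, ← map_one monomial, coeff_monomial,
      if_neg (fun h => by
        have h' := congrArg FreeMonoid.length h
        rw [FreeMonoid.length_one, FreeMonoid.length_mul, FreeMonoid.length_of] at h'
        omega)]
    exact (map_zero (coeffLin w)).symm

lemma star_smul_poly (r : ℝ) (p : Poly σ) : star (r • p) = r • star p := by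
  rw [Algebra.smul_def, star_mul, FreeAlgebra.star_algebraMap, Algebra.smul_def,
    Algebra.commutes]

lemma star_monomial (w : FreeMonoid σ) : star (monomial w) = monomial (star w) := by
  induction w using FreeMonoid.inductionOn' with
  | one => simp
  | of_mul i w ih => rw [map_mul, star_mul, ih, star_mul, map_mul, monomial_of,
      FreeMonoid.star_of, monomial_of, FreeAlgebra.star_ι]

lemma coeff_star (p : Poly σ) (w : FreeMonoid σ) : coeff (star p) w = coeff p (star w) := by
  let S : Poly σ →ₗ[ℝ] Poly σ :=
    { toFun := star, map_add' := star_add, map_smul' := star_smul_poly }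
  have : coeffLin w ∘ₗ S = coeffLin (star w) := by
    refine linearMap_ext fun v => ?_
    change coeff (star (monomial v)) w = coeff (monomial v) (star w)
    rw [star_monomial, coeff_monomial, coeff_monomial]
    congr 1
    exact propext ⟨fun h => by rw [← h, star_star], fun h => by rw [h, star_star]⟩
  exact LinearMap.congr_fun this p

/-! ### Derivatives -/

section Derivative

variable [DecidableEq σ]

/-- The directional derivative as a linear map. -/
def dirdLin (i : σ) (h : Poly σ) : Poly σ →ₗ[ℝ] Poly σ where
  toFun p := dird p i h
  map_add' p q := by simp [dird]
  map_smul' r p := by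
    simp only [dird, map_smul, Polynomial.derivative_smul, RingHom.id_apply]
    simp [← Polynomial.coeff_zero_eq_eval_zero]

lemma dirdLin_apply (i : σ) (h p : Poly σ) : dirdLin i h p = dird p i h := rfl

lemma coeff_zero_shift (i : σ) (h p : Poly σ) : (shift i h p).coeff 0 = p := by
  induction p using FreeAlgebra.induction with
  | grade0 r => simp [Polynomial.algebraMap_apply]
  | grade1 j => rw [shift, FreeAlgebra.lift_ι_apply]; split_ifs <;> simp
  | mul a b ha hb => rw [map_mul, Polynomial.mul_coeff_zero, ha, hb]
  | add a b ha hb => rw [map_add, Polynomial.coeff_add, ha, hb]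

lemma dird_mul (i : σ) (h p q : Poly σ) :
    dird (p * q) i h = dird p i h * q + p * dird q i h := by
  simp only [dird, map_mul, Polynomial.derivative_mul, ← Polynomial.coeff_zero_eq_eval_zero,
    Polynomial.coeff_add, Polynomial.mul_coeff_zero, coeff_zero_shift]

lemma dird_one (i : σ) (h : Poly σ) : dird 1 i h = 0 := by
  simp [dird]

lemma dird_ι (i j : σ) (h : Poly σ) :
    dird (FreeAlgebra.ι ℝ j) i h = if j = i then h else 0 := by
  rw [dird, shift, FreeAlgebra.lift_ι_apply]
  split_ifs <;> simp [Polynomial.derivative_mul]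

end Derivative

/-- Each term replaces one letter by `n`: the length is kept and `n` occurs. -/
lemma dird_mem_supported [DecidableEq σ] (i n : σ) (d : ℕ) {p : Poly σ}
    (hp : p ∈ supported (fun w : FreeMonoid σ => w.length = d)) :
    dird p i (FreeAlgebra.ι ℝ n) ∈
      supported (fun w : FreeMonoid σ => w.length = d ∧ n ∈ w.toList) := by
  suffices h : ∀ w : FreeMonoid σ, dirdLin i (FreeAlgebra.ι ℝ n) (monomial w) ∈
      supported (fun v : FreeMonoid σ => v.length = w.length ∧ n ∈ v.toList) by
    have : supported (fun w : FreeMonoid σ => w.length = d) ≤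
        (supported (fun w : FreeMonoid σ => w.length = d ∧ n ∈ w.toList)).comap
          (dirdLin i (FreeAlgebra.ι ℝ n)) := by
      refine Submodule.span_le.2 ?_
      rintro _ ⟨w, rfl, rfl⟩
      exact h w
    exact this hp
  intro w
  induction w using FreeMonoid.inductionOn' with
  | one => rw [map_one, dirdLin_apply, dird_one]; exact Submodule.zero_mem _
  | of_mul j w ih =>
    rw [map_mul, monomial_of, dirdLin_apply, dird_mul, dird_ι]
    refine Submodule.add_mem _ ?_ (ι_mul_mem_supported j ?_ ih)
    · split_ifs
      · refine ι_mul_mem_supported (P := fun v => v = w) n ?_ (monomial_mem_supported rfl)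
        rintro v rfl
        simp [FreeMonoid.length_mul, FreeMonoid.toList_mul]
      · rw [zero_mul]; exact Submodule.zero_mem _
    · rintro v ⟨hv, hn⟩
      simp [FreeMonoid.length_mul, FreeMonoid.toList_mul, hv, hn]

/-! ### The Laplacian and left quotients -/

variable {g : ℕ}

/-- The inclusion of the polynomials in `x` into the polynomials in `x` and `h`. -/
def adjoinVar : Poly (Fin g) →ₐ[ℝ] Poly (Option (Fin g)) :=
  FreeAlgebra.lift ℝ (fun j : Fin g => FreeAlgebra.ι ℝ (some j))

lemma adjoinVar_monomial (w : FreeMonoid (Fin g)) :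
    adjoinVar (monomial w) = monomial (FreeMonoid.map some w) := by
  induction w using FreeMonoid.inductionOn' with
  | one => simp
  | of_mul j w ih =>
    simp only [map_mul, ih, monomial_of, FreeMonoid.map_of]
    simp [adjoinVar]

/-- The Laplacian as a linear map. -/
def laplacianLin : Poly (Fin g) →ₗ[ℝ] Poly (Option (Fin g)) :=
  ∑ i : Fin g, dirdLin (some i) (FreeAlgebra.ι ℝ none) ∘ₗ
    dirdLin (some i) (FreeAlgebra.ι ℝ none) ∘ₗ adjoinVar.toLinearMap

lemma laplacianLin_apply (p : Poly (Fin g)) : laplacianLin p = laplacian p := by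
  simp only [laplacianLin, LinearMap.sum_apply]
  rfl

lemma laplacian_one : laplacian (1 : Poly (Fin g)) = 0 := by
  simp only [laplacian, map_one, dird_one]
  exact Finset.sum_eq_zero fun i _ => map_zero (dirdLin _ _)

/-- Either both derivatives act on `q`, or exactly one hits the leading letter, in two possible
orders; they cannot both hit it, as h does not depend on x. -/
lemma laplacian_ι_mul (k : Fin g) (q : Poly (Fin g)) :
    laplacian (FreeAlgebra.ι ℝ k * q) = FreeAlgebra.ι ℝ (some k) * laplacian q +
      FreeAlgebra.ι ℝ none *
        ((2 : ℝ) • dird (adjoinVar q) (some k) (FreeAlgebra.ι ℝ none)) := by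
  have key (i : Fin g) : dird (dird (adjoinVar (FreeAlgebra.ι ℝ k * q)) (some i)
        (FreeAlgebra.ι ℝ none)) (some i) (FreeAlgebra.ι ℝ none) =
      FreeAlgebra.ι ℝ (some k) * dird (dird (adjoinVar q) (some i)
        (FreeAlgebra.ι ℝ none)) (some i) (FreeAlgebra.ι ℝ none) +
      if k = i then FreeAlgebra.ι ℝ none *
        ((2 : ℝ) • dird (adjoinVar q) (some k) (FreeAlgebra.ι ℝ none)) else 0 := by
    have h1 : adjoinVar (FreeAlgebra.ι ℝ k : Poly (Fin g)) = FreeAlgebra.ι ℝ (some k) := by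
      simp [adjoinVar]
    rw [map_mul, h1, dird_mul, ← dirdLin_apply (some i) _ (_ + _), map_add, dirdLin_apply,
      dirdLin_apply, dird_mul, dird_mul, dird_ι]
    by_cases h : k = i
    · subst h
      simp [dird_ι, two_smul, mul_add]
      abel
    · have h0 : dird (0 : Poly (Option (Fin g))) (some i) (FreeAlgebra.ι ℝ none) = 0 :=
        map_zero (dirdLin _ _)
      simp [h, h0]
  change ∑ i : Fin g, dird (dird (adjoinVar (FreeAlgebra.ι ℝ k * q)) (some i)
        (FreeAlgebra.ι ℝ none)) (some i) (FreeAlgebra.ι ℝ none) = _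
  simp only [key, Finset.sum_add_distrib, Finset.sum_ite_eq, Finset.mem_univ, if_true,
    ← Finset.mul_sum]
  rfl

/-- Differentiating a letter of the prefix leaves an h there, so an h-free prefix survives only when
both derivatives act after it. -/
lemma leftQuotient_laplacian (u : FreeMonoid (Fin g)) (p : Poly (Fin g)) :
    leftQuotient (FreeMonoid.map some u) (laplacian p) = laplacian (leftQuotient u p) := by
  induction u using FreeMonoid.inductionOn' generalizing p with
  | one => rw [map_one, leftQuotient_one, leftQuotient_one]
  | of_mul j u ih =>
    rw [map_mul, leftQuotient_mul, leftQuotient_mul, ← ih, FreeMonoid.map_of]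
    congr 1
    have : leftQuotient (FreeMonoid.of (some j)) ∘ₗ laplacianLin =
        laplacianLin ∘ₗ leftQuotient (FreeMonoid.of j) := by
      refine linearMap_ext fun w => ?_
      simp only [LinearMap.comp_apply, laplacianLin_apply]
      induction w using FreeMonoid.inductionOn' with
      | one => rw [map_one, laplacian_one, leftQuotient_of_one, map_zero, ← laplacianLin_apply,
          map_zero]
      | of_mul k w _ =>
        rw [map_mul, monomial_of, laplacian_ι_mul, map_add, leftQuotient_of_ι_mul,
          leftQuotient_of_ι_mul, leftQuotient_of_ι_mul, if_neg (Option.some_ne_none j).symm,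
          add_zero]
        by_cases h : k = j
        · simp [h]
        · simp [h, ← laplacianLin_apply]
    simpa only [LinearMap.comp_apply, laplacianLin_apply] using LinearMap.congr_fun this p

lemma laplacian_mem_supported {d : ℕ} {p : Poly (Fin g)} (hp : IsHomogeneous p d) :
    laplacian p ∈ supported
      (fun w : FreeMonoid (Option (Fin g)) => w.length = d ∧ none ∈ w.toList) := by
  have hE : adjoinVar p ∈
      supported (fun w : FreeMonoid (Option (Fin g)) => w.length = d) := by
    have : supported (fun w : FreeMonoid (Fin g) => w.length = d) ≤
        (supported (fun w : FreeMonoid (Option (Fin g)) => w.length = d)).comap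
          adjoinVar.toLinearMap := by
      refine Submodule.span_le.2 ?_
      rintro _ ⟨w, rfl, rfl⟩
      change adjoinVar (monomial w) ∈ supported _
      rw [adjoinVar_monomial]
      exact monomial_mem_supported (List.length_map _)
    exact this (isHomogeneous_iff.1 hp)
  -- The outer derivative supplies the letter h; the inner one only has to preserve the degree.
  refine Submodule.sum_mem _ fun i _ => dird_mem_supported _ _ _ ?_
  refine mem_supported.2 fun w hw => ?_
  exact (mem_supported.1 (dird_mem_supported (some i) none d hE) w hw).1

/-! ### Positivity tested on labelled paths -/

lemma _root_.Matrix.PosSemidef.apply_eq_zero_of_diag_eq_zero {n : Type*} {A : Matrix n n ℝ}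
    (hA : A.PosSemidef) {i : n} (h : A i i = 0) (j : n) : A i j = 0 := by
  have h2 := (hA.submatrix ![i, j]).det_nonneg
  have h3 : A j i = A i j := by simpa using hA.isHermitian.apply i j
  rw [Matrix.det_fin_two] at h2
  simp only [Matrix.submatrix_apply, Matrix.cons_val_zero, Matrix.cons_val_one, h, h3] at h2
  nlinarith [mul_self_nonneg (A i j)]

lemma evalMatrix_monomial {n : ℕ} (X : σ → Matrix (Fin n) (Fin n) ℝ) (w : FreeMonoid σ) :
    evalMatrix X (monomial w) = FreeMonoid.lift X w := by
  induction w using FreeMonoid.inductionOn' with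
  | one => simp [evalMatrix]
  | of_mul j w ih =>
    rw [map_mul, map_mul, evalMatrix, map_mul, ← evalMatrix, ← evalMatrix, ih, monomial_of]
    simp [evalMatrix]

lemma evalMatrix_apply {n : ℕ} (X : σ → Matrix (Fin n) (Fin n) ℝ) (p : Poly σ) (a b : Fin n) :
    evalMatrix X p a b =
      ∑ w ∈ (coeffEquiv p).support, coeff p w * (FreeMonoid.lift X w : Matrix _ _ ℝ) a b := by
  conv_lhs => rw [eq_sum_monomial p, evalMatrix, map_sum]
  rw [Matrix.sum_apply]
  refine Finset.sum_congr rfl fun w _ => ?_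
  rw [map_smul, Matrix.smul_apply, smul_eq_mul, ← evalMatrix, evalMatrix_monomial]

open Classical in
/-- The adjacency matrix of the edges labelled `i` in the path whose successive edges are
labelled by the word `s`. -/
def pathMatrix (s : List σ) (i : σ) : Matrix (Fin (s.length + 1)) (Fin (s.length + 1)) ℝ :=
  fun a b =>
    if (b.1 = a.1 + 1 ∧ s[a.1]? = some i) ∨ (a.1 = b.1 + 1 ∧ s[b.1]? = some i) then 1 else 0

lemma pathMatrix_isSymm (s : List σ) (i : σ) : (pathMatrix s i).IsSymm := by
  ext a b
  rw [Matrix.transpose_apply, pathMatrix, pathMatrix]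
  congr 1
  exact propext or_comm

lemma pathMatrix_ne_zero {s : List σ} {i : σ} {a b : Fin (s.length + 1)}
    (h : pathMatrix s i a b ≠ 0) :
    (b.1 = a.1 + 1 ∧ s[a.1]? = some i) ∨ (a.1 = b.1 + 1 ∧ s[b.1]? = some i) := by
  by_contra hc
  exact h (if_neg hc)

/-- The matrix of a word at the path matrices of `s`. -/
def pathWord (s : List σ) (w : FreeMonoid σ) :
    Matrix (Fin (s.length + 1)) (Fin (s.length + 1)) ℝ :=
  FreeMonoid.lift (pathMatrix s) w

/-- Entries count walks on the path that read `w`, and each letter moves by exactly one vertex. -/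
lemma pathWord_band (s : List σ) (w : FreeMonoid σ) {a b : Fin (s.length + 1)}
    (h : pathWord s w a b ≠ 0) : a.1 ≤ b.1 + w.length ∧ b.1 ≤ a.1 + w.length := by
  induction w using FreeMonoid.inductionOn' generalizing a with
  | one =>
    have : a = b := by
      by_contra hab
      exact h (by simp [pathWord, Matrix.one_apply_ne hab])
    simp [this]
  | of_mul i w ih =>
    rw [pathWord, map_mul, Matrix.mul_apply] at h
    obtain ⟨c, -, hc⟩ := Finset.exists_ne_zero_of_sum_ne_zero h
    have h1 := ih (a := c) (right_ne_zero_of_mul hc)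
    have h2 := left_ne_zero_of_mul hc
    rw [FreeMonoid.lift_eval_of] at h2
    have h3 := pathMatrix_ne_zero h2
    rw [FreeMonoid.length_mul, FreeMonoid.length_of]
    omega

open Classical in
-- At maximal distance the only possible walk steps right every time, so it reads consecutive labels
-- of `s`.
lemma pathWord_straight (s : List σ) (w : FreeMonoid σ) {a b : Fin (s.length + 1)}
    (h : b.1 = a.1 + w.length) :
    pathWord s w a b = if w.toList <+: s.drop a then 1 else 0 := by
  induction w using FreeMonoid.inductionOn' generalizing a with
  | one =>
    have : a = b := by ext; simpa using h.symm
    simp [pathWord, this]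
  | of_mul i w ih =>
    rw [FreeMonoid.length_mul, FreeMonoid.length_of] at h
    have hb := b.2
    have ha : a.1 < s.length := by omega
    have : pathWord s (FreeMonoid.of i * w) a b =
        ∑ c, pathMatrix s i a c * pathWord s w c b := by
      rw [pathWord, map_mul, Matrix.mul_apply, FreeMonoid.lift_eval_of]; rfl
    rw [this, Finset.sum_eq_single (⟨a.1 + 1, by omega⟩ : Fin (s.length + 1))]
    · have hp : (FreeMonoid.of i * w).toList <+: s.drop a ↔
          i = s[a.1] ∧ w.toList <+: s.drop (a.1 + 1) := by
        rw [List.drop_eq_getElem_cons ha, FreeMonoid.toList_mul,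
          FreeMonoid.toList_of, List.singleton_append, List.cons_prefix_cons]
      rw [ih (by simp only; omega), if_congr hp rfl rfl]
      simp only [pathMatrix, List.getElem?_eq_getElem ha, Option.some.injEq]
      by_cases hi : s[a.1] = i
      · simp [hi]
      · have : ¬ i = s[a.1] := fun h => hi h.symm
        simp [hi, this]; omega
    · intro c _ hc
      by_contra hne
      have h1 := pathWord_band s w (right_ne_zero_of_mul hne)
      have h2 := pathMatrix_ne_zero (left_ne_zero_of_mul hne)
      apply hc
      ext
      simp only
      omega
    · simp

/-- Edges labelled `n` start at distance at least `m` from vertex 0, so a closed walk crossing one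
has length at least 2m + 2. -/
lemma pathWord_corner_eq_zero {s : List σ} {n : σ} {m : ℕ} (hs : n ∉ s.take m)
    {w : FreeMonoid σ} (hw : n ∈ w.toList) (hlen : w.length ≤ 2 * m) :
    pathWord s w 0 0 = 0 := by
  obtain ⟨u, v, huv⟩ := List.append_of_mem hw
  have hw' : w = FreeMonoid.ofList u * (FreeMonoid.of n * FreeMonoid.ofList v) := huv
  subst hw'
  simp only [FreeMonoid.length_mul, FreeMonoid.length_of] at hlen
  rw [pathWord, map_mul, map_mul, Matrix.mul_apply]
  refine Finset.sum_eq_zero fun a _ => ?_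
  rw [Matrix.mul_apply, Finset.mul_sum]
  refine Finset.sum_eq_zero fun b _ => ?_
  by_contra hne
  have h1 := pathWord_band s (FreeMonoid.ofList u) (left_ne_zero_of_mul hne)
  have h2 := pathWord_band s (FreeMonoid.ofList v)
    (right_ne_zero_of_mul (right_ne_zero_of_mul hne))
  have h3 := left_ne_zero_of_mul (right_ne_zero_of_mul hne)
  rw [FreeMonoid.lift_eval_of] at h3
  have key (e : ℕ) (he : s[e]? = some n) : m ≤ e := by
    by_contra hlt
    push Not at hlt
    exact hs (List.mem_of_getElem? (i := e) (by rw [List.getElem?_take_of_lt hlt, he]))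
  simp only [Fin.val_zero] at h1 h2
  rcases pathMatrix_ne_zero h3 with ⟨h4, h5⟩ | ⟨h4, h5⟩
  · have := key _ h5; omega
  · have := key _ h5; omega

/-- In a matrix positive polynomial all of whose monomials have degree `2 * m` and contain the
variable `n`, no monomial is free of `n` in its first `m` letters. -/
lemma IsMatrixPositive.coeff_eq_zero {q : Poly σ} (hq : IsMatrixPositive q) {n : σ} {m : ℕ}
    (hsupp : q ∈ supported (fun w : FreeMonoid σ => w.length = 2 * m ∧ n ∈ w.toList))
    {s : FreeMonoid σ} (hs : n ∉ s.toList.take m) : coeff q s = 0 := by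
  classical
  by_contra hne
  have hsl : s.toList.length = 2 * m := (mem_supported.1 hsupp s hne).1
  have hpos := hq.2 _ (pathMatrix s.toList) (pathMatrix_isSymm _)
  have h0 : evalMatrix (pathMatrix s.toList) q 0 0 = 0 := by
    rw [evalMatrix_apply]
    refine Finset.sum_eq_zero fun w hw => ?_
    obtain ⟨h1, h2⟩ := mem_supported.1 hsupp w (mem_support.1 hw)
    exact mul_eq_zero_of_right _ (pathWord_corner_eq_zero hs h2 h1.le)
  -- The entry between the two ends vanishes too; among words of length 2m only `s` contributes to
  -- it.
  have h1 := hpos.apply_eq_zero_of_diag_eq_zero h0 (Fin.last _)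
  rw [evalMatrix_apply, Finset.sum_eq_single s] at h1
  · have : pathWord s.toList s 0 (Fin.last _) = 1 := by
      rw [pathWord_straight _ _ (by simp; rfl)]
      simp
    exact hne (by simpa [pathWord] using h1.symm.trans (congrArg _ this) |>.symm)
  · intro w hw hws
    have hl : w.length = 2 * m := (mem_supported.1 hsupp w (mem_support.1 hw)).1
    refine mul_eq_zero_of_right _ ?_
    change pathWord s.toList w 0 (Fin.last _) = 0
    rw [pathWord_straight _ _ (by simp [hl, hsl]), if_neg]
    intro hpre
    exact hws (hpre.eq_of_length (by simp [hsl]; exact hl))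
  · intro hs
    exact absurd (mem_support.2 hne) hs

/-! ### Half-words and diagonalization -/

lemma IsHomogeneous.eq_sum_vector [Fintype σ] {p : Poly σ} {m : ℕ} (hp : IsHomogeneous p m) :
    p = ∑ v : List.Vector σ m,
      coeff p (FreeMonoid.ofList v.toList) • monomial (FreeMonoid.ofList v.toList) := by
  classical
  refine ext_coeff fun w => ?_
  rw [← coeffLin_apply w (∑ _, _), map_sum]
  simp only [map_smul, coeffLin_apply, coeff_monomial, smul_eq_mul, mul_ite, mul_one, mul_zero]
  by_cases hw : w.length = m
  · obtain ⟨v, hv⟩ : ∃ v : List.Vector σ m, FreeMonoid.ofList v.toList = w :=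
      ⟨⟨w.toList, hw⟩, rfl⟩
    rw [Finset.sum_eq_single v, hv, if_pos rfl]
    · intro u _ hu
      exact if_neg fun h => hu (List.Vector.eq _ _ (h.trans hv.symm))
    · exact fun h => absurd (Finset.mem_univ _) h
  · have h0 : coeff p w = 0 := by
      by_contra h
      exact hw (hp w h)
    rw [h0]
    refine (Finset.sum_eq_zero fun v _ => if_neg ?_).symm
    rintro rfl
    exact hw v.2

lemma isHomogeneous_leftQuotient {p : Poly σ} {m n : ℕ} (hp : IsHomogeneous p (m + n))
    {u : FreeMonoid σ} (hu : u.length = m) : IsHomogeneous (leftQuotient u p) n := by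
  intro w hw
  rw [coeff_leftQuotient] at hw
  have := hp _ hw
  rw [FreeMonoid.length_mul] at this
  omega

/-- A homogeneous polynomial of degree `m + m` expanded along the reversed first halves of its
monomials. -/
lemma IsHomogeneous.eq_sum_star_mul_leftQuotient [Fintype σ] {p : Poly σ} {m : ℕ}
    (hp : IsHomogeneous p (m + m)) :
    p = ∑ u : List.Vector σ m, star (monomial (FreeMonoid.ofList u.toList)) *
      leftQuotient (star (FreeMonoid.ofList u.toList)) p := by
  let F : Poly σ →ₗ[ℝ] Poly σ := ∑ u : List.Vector σ m,
    LinearMap.mulLeft ℝ (star (monomial (FreeMonoid.ofList u.toList))) ∘ₗ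
      leftQuotient (star (FreeMonoid.ofList u.toList))
  suffices h : supported (fun w : FreeMonoid σ => w.length = m + m) ≤
      LinearMap.eqLocus LinearMap.id F by
    have := h (isHomogeneous_iff.1 hp)
    simpa [F, LinearMap.sum_apply] using this
  refine Submodule.span_le.2 ?_
  rintro _ ⟨w, hw, rfl⟩
  classical
  change monomial w = F (monomial w)
  have hw' : w.toList.length = m + m := hw
  have hsplit : w = FreeMonoid.ofList (w.toList.take m) * FreeMonoid.ofList (w.toList.drop m) :=
    (List.take_append_drop m w.toList).symm
  have hquot (u v : FreeMonoid σ) : NCPoly.leftQuotient u (monomial (u * v)) = monomial v :=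
    ext_coeff fun x => by
      rw [coeff_leftQuotient, coeff_monomial, coeff_monomial]
      exact if_congr (mul_right_injective u).eq_iff rfl rfl
  simp only [F, LinearMap.sum_apply, LinearMap.comp_apply, LinearMap.mulLeft_apply]
  -- The sum is indexed by reversed prefixes, so the one surviving index is the reversal of the
  -- first half of `w`.
  obtain ⟨u, hu⟩ : ∃ u : List.Vector σ m, u.toList = (w.toList.take m).reverse :=
    ⟨⟨(w.toList.take m).reverse, by simp [hw']⟩, rfl⟩
  have hs : star (FreeMonoid.ofList u.toList) = FreeMonoid.ofList (w.toList.take m) := by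
    rw [hu]
    exact List.reverse_reverse _
  rw [Finset.sum_eq_single u]
  · have h := hquot (FreeMonoid.ofList (w.toList.take m)) (FreeMonoid.ofList (w.toList.drop m))
    rw [← hsplit] at h
    rw [star_monomial, hs, h, ← map_mul, ← hsplit]
  · intro v _ hv
    refine mul_eq_zero_of_right _ (ext_coeff fun x => ?_)
    rw [coeff_leftQuotient, coeff_monomial, if_neg]
    · exact (map_zero (coeffLin x)).symm
    · intro h
      have h2 : w.toList = v.toList.reverse ++ x.toList := h
      refine hv (List.Vector.eq _ _ ?_)
      rw [hu, h2, List.take_append_of_le_length (by simp), List.take_of_length_le (by simp),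
        List.reverse_reverse]
  · exact fun h => absurd (Finset.mem_univ _) h

/-- If `p` is subharmonic, its quotients by words of half its degree are harmonic. -/
lemma IsSubharmonic.isHarmonic_leftQuotient {g : ℕ} {p : Poly (Fin g)} (hp : IsSubharmonic p)
    {m : ℕ} (hom : IsHomogeneous p (2 * m)) {u : FreeMonoid (Fin g)} (hu : u.length = m) :
    IsHarmonic (leftQuotient u p) := by
  rw [IsHarmonic, ← leftQuotient_laplacian]
  refine ext_coeff fun w => ?_
  rw [coeff_leftQuotient, IsMatrixPositive.coeff_eq_zero hp (laplacian_mem_supported hom)]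
  · exact (map_zero (coeffLin w)).symm
  · have h1 : (FreeMonoid.map some u * w).toList = u.toList.map some ++ w.toList := rfl
    have h2 : (u.toList.map some).length = m := (List.length_map _).trans hu
    rw [h1, List.take_append_of_le_length h2.ge, List.take_of_length_le h2.le]
    simp

lemma _root_.Matrix.IsHermitian.apply_eq_sum {n : Type*} [Fintype n] [DecidableEq n]
    {A : Matrix n n ℝ} (hA : A.IsHermitian) (u v : n) :
    A u v = ∑ i, hA.eigenvalues i * (hA.eigenvectorBasis i u * hA.eigenvectorBasis i v) := by
  conv_lhs => rw [hA.spectral_theorem, Unitary.conjStarAlgAut_apply]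
  rw [Matrix.mul_apply]
  refine Finset.sum_congr rfl fun i _ => ?_
  rw [Matrix.mul_diagonal, Matrix.star_apply, Matrix.IsHermitian.eigenvectorUnitary_apply,
    Matrix.IsHermitian.eigenvectorUnitary_apply]
  simp
  ring

/-- A symmetric homogeneous polynomial of degree `m + m` is a linear combination of squares of
linear combinations of its quotients by words of length `m`. -/
lemma IsSymmetric.exists_eq_sum_star_mul {g m : ℕ} {p : Poly (Fin g)} (hs : IsSymmetric p)
    (hp : IsHomogeneous p (m + m)) :
    ∃ (c : List.Vector (Fin g) m → ℝ) (e : List.Vector (Fin g) m → List.Vector (Fin g) m → ℝ),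
      p = ∑ i, c i • (star (∑ u, e i u • leftQuotient (star (FreeMonoid.ofList u.toList)) p) *
        ∑ u, e i u • leftQuotient (star (FreeMonoid.ofList u.toList)) p) := by
  let W (u : List.Vector (Fin g) m) : FreeMonoid (Fin g) := FreeMonoid.ofList u.toList
  let A : Matrix (List.Vector (Fin g) m) (List.Vector (Fin g) m) ℝ :=
    fun u v => coeff p (star (W u) * W v)
  have hA : A.IsHermitian := by
    ext u v
    change coeff p _ = coeff p _
    conv_lhs => rw [← hs, coeff_star, star_mul, star_star]
  have hq (u : List.Vector (Fin g) m) :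
      leftQuotient (star (W u)) p = ∑ v, A u v • monomial (W v) := by
    have h := (isHomogeneous_leftQuotient (u := star (W u)) hp
      ((List.length_reverse).trans u.2)).eq_sum_vector
    simpa only [coeff_leftQuotient] using h
  -- The combination of quotients along an eigenvector is λ times the same combination of monomials,
  -- so its square carries λ² and the weight λ⁻¹ restores λ. For λ = 0 the combination is 0 and the
  -- convention 0⁻¹ = 0 is harmless.
  refine ⟨fun i => (hA.eigenvalues i)⁻¹, fun i => hA.eigenvectorBasis i, ?_⟩
  have hR (i : List.Vector (Fin g) m) :
      ∑ u, hA.eigenvectorBasis i u • leftQuotient (star (W u)) p =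
        hA.eigenvalues i • ∑ v, hA.eigenvectorBasis i v • monomial (W v) := by
    simp only [hq, Finset.smul_sum, smul_smul]
    rw [Finset.sum_comm]
    refine Finset.sum_congr rfl fun v _ => ?_
    rw [← Finset.sum_smul]
    congr 1
    have h := congrFun (hA.mulVec_eigenvectorBasis i) v
    rw [Matrix.mulVec, dotProduct] at h
    refine Eq.trans (Finset.sum_congr rfl fun u _ => ?_) h
    rw [mul_comm]
    congr 1
    exact hA.apply v u
  change p = ∑ i, (hA.eigenvalues i)⁻¹ •
    (star (∑ u, hA.eigenvectorBasis i u • leftQuotient (star (W u)) p) *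
      ∑ u, hA.eigenvectorBasis i u • leftQuotient (star (W u)) p)
  have hsq (i : List.Vector (Fin g) m) : (hA.eigenvalues i)⁻¹ •
      (star (∑ u, hA.eigenvectorBasis i u • leftQuotient (star (W u)) p) *
        ∑ u, hA.eigenvectorBasis i u • leftQuotient (star (W u)) p) =
      ∑ u, ∑ v, (hA.eigenvalues i * (hA.eigenvectorBasis i u * hA.eigenvectorBasis i v)) •
        (star (monomial (W u)) * monomial (W v)) := by
    rw [hR, star_smul_poly, smul_mul_smul_comm, smul_smul, star_sum, Finset.sum_mul_sum,
      show (hA.eigenvalues i)⁻¹ * (hA.eigenvalues i * hA.eigenvalues i) = hA.eigenvalues i by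
        by_cases h : hA.eigenvalues i = 0
        · simp [h]
        · field_simp]
    simp only [star_smul_poly, smul_mul_smul_comm, Finset.smul_sum, smul_smul]
  simp only [hsq]
  conv_lhs => rw [hp.eq_sum_star_mul_leftQuotient]
  rw [Finset.sum_comm]
  refine Finset.sum_congr rfl fun u _ => ?_
  change star (monomial (W u)) * leftQuotient (star (W u)) p = _
  rw [hq, Finset.mul_sum, Finset.sum_comm]
  refine Finset.sum_congr rfl fun v _ => ?_
  rw [← Finset.sum_smul, ← hA.apply_eq_sum, mul_smul_comm]

end NCPoly

end

theorem theorem1p2 (g d : ℕ) (hd : Even d) (k : ℕ) (γ : Fin k → NCPoly.Poly (Fin g))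
    (hγ_indep : LinearIndependent ℝ γ)
    (hγ_span : ∀ q : NCPoly.Poly (Fin g),
      q ∈ Submodule.span ℝ (Set.range γ) ↔
        NCPoly.IsHomogeneous q (d / 2) ∧ NCPoly.IsHarmonic q)
    (hγ_mon : ∀ j : Fin k, ∃ w : FreeMonoid (Fin g),
      NCPoly.coeff (γ j) w ≠ 0 ∧ ∀ l : Fin k, l ≠ j → NCPoly.coeff (γ l) w = 0)
    (p : NCPoly.Poly (Fin g)) (hp_hom : NCPoly.IsHomogeneous p d)
    (hp_symm : NCPoly.IsSymmetric p) (hp_sub : NCPoly.IsSubharmonic p) :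
    ∃ (N : ℕ) (c : Fin N → ℝ) (R : Fin N → NCPoly.Poly (Fin g)),
      (∀ i, NCPoly.IsHomogeneous (R i) (d / 2) ∧ NCPoly.IsHarmonic (R i)) ∧
        p = ∑ i, c i • (star (R i) * R i) := by
  obtain ⟨m, rfl⟩ := hd
  obtain ⟨c, e, h⟩ := hp_symm.exists_eq_sum_star_mul hp_hom
  have hm : (m + m) / 2 = m := by omega
  have hmem (i : List.Vector (Fin g) m) :
      ∑ u, e i u • NCPoly.leftQuotient (star (FreeMonoid.ofList u.toList)) p ∈
        Submodule.span ℝ (Set.range γ) := by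
    -- Membership in the span of `γ` transfers harmonicity and homogeneity from the quotients to
    -- their linear combinations.
    refine Submodule.sum_mem _ fun u _ => Submodule.smul_mem _ _ ((hγ_span _).2 ?_)
    have hu : (star (FreeMonoid.ofList u.toList)).length = m :=
      (List.length_reverse).trans u.2
    rw [hm]
    exact ⟨NCPoly.isHomogeneous_leftQuotient hp_hom hu,
      hp_sub.isHarmonic_leftQuotient (by rwa [two_mul]) hu⟩
  let E := (Fintype.equivFin (List.Vector (Fin g) m)).symm
  refine ⟨_, fun i => c (E i), fun i => ∑ u, e (E i) u •
    NCPoly.leftQuotient (star (FreeMonoid.ofList u.toList)) p,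
    fun i => (hγ_span _).1 (hmem (E i)), ?_⟩
  conv_lhs => rw [h]
  exact (E.sum_comp fun i => c i • (star (∑ u, e i u •
    NCPoly.leftQuotient (star (FreeMonoid.ofList u.toList)) p) *
      ∑ u, e i u • NCPoly.leftQuotient (star (FreeMonoid.ofList u.toList)) p)).symm
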